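/- Let $n \ge 2$ and let $K \subset \mathbb{R}^n$ be a symmetric convex body, that is, a compact convex set with nonempty interior such that $K = -K$. Suppose that there is a nonempty relatively open subset $U$ of the boundary $\partial K$ such that $\partial K$ is a hypersurface of class $C^2$ near every point of $U$ and all the principal curvatures of $\partial K$ (with respect to the outward unit normal $\nu$, i.e. the eigenvalues of the differential of $\nu$ on the tangent space) are positive at every point of $U$. Then $K$ is SRS-decomposable: there exist a vector $v \in \mathbb{R}^n \setminus \{0\}$, a number $\epsilon > 0$ and a function $\beta : \pi_v(K) \to \mathbb{R}$, where $\pi_v : \mathbb{R}^n \to v^\perp$ is the orthogonal projection, such that $\beta$ is odd ($\beta(-x) = -\beta(x)$ for all $x \in \pi_v(K)$), $\beta$ is not the restriction to $\pi_v(K)$ of a linear function on $v^\perp$, and for every $t \in (-\epsilon, \epsilon)$ the set $$K_t = \{ x + t \beta(\pi_v(x)) v : x \in K \}$$ is convex. -/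

import Mathlib

open scoped InnerProductSpace Pointwise

noncomputable section

namespace SRS

/-- Euclidean space `ℝⁿ`. -/
abbrev E (n : ℕ) := EuclideanSpace ℝ (Fin n)

/-- A symmetric convex body: a compact convex set with nonempty interior and `-K = K`. -/
structure IsSymmConvexBody {n : ℕ} (K : Set (E n)) : Prop where
  convex : Convex ℝ K
  isCompact : IsCompact K
  interior_nonempty : (interior K).Nonempty
  neg_eq : -K = K

/-- The hyperplane `v^⊥`. -/
abbrev perp {n : ℕ} (v : E n) : Submodule ℝ (E n) := (Submodule.span ℝ {v})ᗮ

/-- Orthogonal projection `π_v : ℝⁿ → v^⊥`. -/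
abbrev proj {n : ℕ} (v : E n) : E n →L[ℝ] perp v := (perp v).orthogonalProjectionOnto

/-- The set `K_t = {x + t β(π_v x) v : x ∈ K}`. Only the values of `β` on `π_v(K)` matter. -/
def move {n : ℕ} (K : Set (E n)) (v : E n) (β : perp v → ℝ) (t : ℝ) : Set (E n) :=
  (fun x => x + (t * β (proj v x)) • v) '' K

/-- The family `K_t`, `t ∈ I`, with direction `v ≠ 0` and speed function `β`, is an RS-movement
of `K`: `I` is an interval containing `0` and each `K_t` is convex. -/
structure IsRSMovement {n : ℕ} (K : Set (E n)) (v : E n) (β : perp v → ℝ) (I : Set ℝ) :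
    Prop where
  ne_zero : v ≠ 0
  ordConnected : I.OrdConnected
  zero_mem : (0 : ℝ) ∈ I
  convex : ∀ t ∈ I, Convex ℝ (move K v β t)

/-- An SRS-movement: an RS-movement whose speed function is odd on `π_v(K)`. -/
structure IsSRSMovement {n : ℕ} (K : Set (E n)) (v : E n) (β : perp v → ℝ) (I : Set ℝ) : Prop
    extends IsRSMovement K v β I where
  odd : ∀ x ∈ proj v '' K, β (-x) = -β x

/-- `β` is (the restriction of) a linear function on the set `S`. -/
def IsLinearOn {n : ℕ} {v : E n} (β : perp v → ℝ) (S : Set (perp v)) : Prop :=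
  ∃ l : perp v →ₗ[ℝ] ℝ, ∀ x ∈ S, β x = l x

/-- `K` is SRS-decomposable: there is an SRS-movement `K_t`, `t ∈ (-ε, ε)`, with `K_0 = K`, whose
speed function is not linear on `π_v(K)`. -/
def SRSDecomposable {n : ℕ} (K : Set (E n)) : Prop :=
  ∃ (v : E n) (β : perp v → ℝ) (ε : ℝ), 0 < ε ∧
    IsSRSMovement K v β (Set.Ioo (-ε) ε) ∧ move K v β 0 = K ∧
    ¬ IsLinearOn β (proj v '' K)

/-- `ρ` is a `C²` local defining function of `∂K` on the open neighbourhood `W` of `p ∈ ∂K`: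
inside `W`, the boundary is the regular zero set of `ρ`. It is oriented so that `ρ < 0` inside `K`,
i.e. `∇ρ` is an outward normal of `∂K`. -/
structure IsLocalDefining {n : ℕ} (K : Set (E n)) (p : E n) (W : Set (E n)) (ρ : E n → ℝ) :
    Prop where
  mem_frontier : p ∈ frontier K
  isOpen : IsOpen W
  mem : p ∈ W
  contDiffOn : ContDiffOn ℝ 2 ρ W
  gradient_ne_zero : ∀ x ∈ W, gradient ρ x ≠ 0
  frontier_iff : ∀ x ∈ W, x ∈ frontier K ↔ ρ x = 0
  neg_interior : ∀ x ∈ W, x ∈ interior K → ρ x < 0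

/-- `∂K` is a hypersurface of class `C²` near `p`. -/
def BoundaryC2At {n : ℕ} (K : Set (E n)) (p : E n) : Prop :=
  ∃ (W : Set (E n)) (ρ : E n → ℝ), IsLocalDefining K p W ρ

/-- The unit normal field `∇ρ / |∇ρ|` of the level sets of `ρ`. -/
def unitNormal {n : ℕ} (ρ : E n → ℝ) (x : E n) : E n := ‖gradient ρ x‖⁻¹ • gradient ρ x

/-- `κ` is a principal curvature of `∂K` at `p`: an eigenvalue, with an eigenvector in the tangent
space `T_p ∂K = (∇ρ(p))^⊥`, of the Weingarten map, the differential of the outward unit normal.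
(This does not depend on the choice of the local defining function. The sign is such that the unit
sphere, as the boundary of the unit ball, has all principal curvatures `1`.) -/
def IsPrincipalCurvature {n : ℕ} (K : Set (E n)) (p : E n) (κ : ℝ) : Prop :=
  ∃ (W : Set (E n)) (ρ : E n → ℝ), IsLocalDefining K p W ρ ∧
    ∃ w : E n, w ≠ 0 ∧ ⟪gradient ρ p, w⟫_ℝ = 0 ∧ fderiv ℝ (unitNormal ρ) p w = κ • w

end SRS

end

/-!
At a boundary point `p` where all principal curvatures are positive, the Hessian of a local defining
function `ρ` is positive definite on the tangent space. Adding a large multiple of `ρ ^ 2` makes it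
positive definite in every direction without changing the sign of `ρ` near `p`, so `K` is, near `p`,
a sublevel set of a strongly convex function: around the midpoint of points `x` and `y` it contains
a ball of radius comparable to `|x - y| ^ 2`.

Now let `q` be a boundary point near `p` which is not a multiple of `p`, and project along
`v = p - q`. The upper boundary of `K` is the graph of a concave function over the shadow of `K` in
`v^⊥`. Since `p` lies above the interior of `K`, and so does `-q` by symmetry, this function is
strongly concave near the projections `x₀` of `p` and `-x₀` of `-q`. It therefore stays concave when
a small multiple of an odd `C²` bump `β` supported near `± x₀` is added to it. As `β` is odd, the
lower boundary moves by the same amount as the upper one, and it is described by the same function,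
so the moved body is convex.
-/

namespace SRS

open Filter Topology Metric Set Module

section Coercivity

theorem exists_coercive_of_hasEigenvalue_pos {F : Type*} [NormedAddCommGroup F]
    [InnerProductSpace ℝ F] [FiniteDimensional ℝ F] {T : F →ₗ[ℝ] F} (hT : T.IsSymmetric)
    (hpos : ∀ μ, End.HasEigenvalue T μ → 0 < μ) :
    ∃ κ : ℝ, 0 < κ ∧ ∀ x, κ * ‖x‖ ^ 2 ≤ ⟪T x, x⟫_ℝ := by
  rcases subsingleton_or_nontrivial F with _ | _
  · exact ⟨1, one_pos, fun x => by simp [Subsingleton.elim x 0]⟩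
  refine ⟨_, hpos _ hT.hasEigenvalue_iInf_of_finiteDimensional, fun x => ?_⟩
  rcases eq_or_ne x 0 with rfl | hx
  · simp
  rw [← le_div_iff₀ (by positivity)]
  refine ciInf_le (f := fun y : {y : F // y ≠ 0} => ⟪T y, y⟫_ℝ / ‖(y : F)‖ ^ 2) ?_ ⟨x, hx⟩
  refine ⟨-‖T.toContinuousLinearMap‖, ?_⟩
  rintro _ ⟨y, rfl⟩
  exact neg_le_of_abs_le (T.toContinuousLinearMap.rayleighQuotient_le_norm y)

variable {V : Type*} [NormedAddCommGroup V] [NormedSpace ℝ V]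

theorem le_apply_add_smul_self (B : V →L[ℝ] V →L[ℝ] ℝ) (u e : V) (s : ℝ) :
    B u u - 2 * (‖B‖ * ‖e‖) * |s| * ‖u‖ - ‖B‖ * ‖e‖ * ‖e‖ * s ^ 2 ≤
      B (u + s • e) (u + s • e) := by
  have hexpand : B (u + s • e) (u + s • e) = B u u + s * (B u e + B e u) + s ^ 2 * B e e := by
    simp only [map_add, map_smul, add_apply, smul_apply, smul_eq_mul]
    ring
  have hcross : -(|s| * (2 * (‖B‖ * ‖e‖) * ‖u‖)) ≤ s * (B u e + B e u) := by
    have hsum : |B u e + B e u| ≤ 2 * (‖B‖ * ‖e‖) * ‖u‖ := by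
      calc |B u e + B e u| ≤ |B u e| + |B e u| := abs_add_le _ _
        _ ≤ ‖B‖ * ‖u‖ * ‖e‖ + ‖B‖ * ‖e‖ * ‖u‖ := add_le_add (B.le_opNorm₂ u e) (B.le_opNorm₂ e u)
        _ = 2 * (‖B‖ * ‖e‖) * ‖u‖ := by ring
    refine neg_le_of_abs_le ?_
    rw [abs_mul]
    gcongr
  have hee := mul_le_mul_of_nonneg_left (neg_le_of_abs_le (B.le_opNorm₂ e e)) (sq_nonneg s)
  rw [hexpand]
  linear_combination hcross + hee

-- Split `w = u + s • e` with `ℓ u = 0` and `ℓ e = 1`; Young's inequality absorbs the cross terms.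
theorem exists_coercive_add_mul_sq (B : V →L[ℝ] V →L[ℝ] ℝ) (ℓ : V →L[ℝ] ℝ) {κ : ℝ} (hκ : 0 < κ)
    (hB : ∀ u, ℓ u = 0 → κ * ‖u‖ ^ 2 ≤ B u u) :
    ∃ A c : ℝ, 0 < c ∧ ∀ w, c * ‖w‖ ^ 2 ≤ B w w + A * ℓ w ^ 2 := by
  rcases eq_or_ne ℓ 0 with rfl | hℓ
  · exact ⟨0, κ, hκ, fun w => by simpa using hB w rfl⟩
  obtain ⟨x, hx⟩ := ContinuousLinearMap.exists_ne_zero hℓ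
  obtain ⟨e, he⟩ : ∃ e, ℓ e = 1 := ⟨(ℓ x)⁻¹ • x, by simp [hx]⟩
  set b := ‖B‖ * ‖e‖ with hb
  refine ⟨2 * b ^ 2 / κ + b * ‖e‖ + κ / 2 * ‖e‖ ^ 2, κ / 4, by positivity, fun w => ?_⟩
  set s := ℓ w
  obtain ⟨u, hw, hu⟩ : ∃ u, w = u + s • e ∧ ℓ u = 0 := ⟨w - s • e, by simp, by simp [s, he]⟩
  have hBw := le_apply_add_smul_self B u e s
  rw [← hw, ← hb] at hBw
  have hBu : κ * ‖u‖ ^ 2 ≤ B u u := hB u hu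
  have hnorm : ‖w‖ ^ 2 ≤ 2 * ‖u‖ ^ 2 + 2 * (|s| * ‖e‖) ^ 2 := by
    have htri : ‖w‖ ≤ ‖u‖ + |s| * ‖e‖ := by
      rw [hw, ← Real.norm_eq_abs, ← norm_smul]; exact norm_add_le _ _
    nlinarith [norm_nonneg w, sq_nonneg (‖u‖ - |s| * ‖e‖)]
  have hyoung : 2 * b * |s| * ‖u‖ ≤ κ / 2 * ‖u‖ ^ 2 + 2 * b ^ 2 / κ * |s| ^ 2 := by
    have hsq : 0 ≤ κ / 2 * (‖u‖ - 2 * b / κ * |s|) ^ 2 := by positivity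
    have hexp : κ / 2 * (‖u‖ - 2 * b / κ * |s|) ^ 2 =
        κ / 2 * ‖u‖ ^ 2 + 2 * b ^ 2 / κ * |s| ^ 2 - 2 * b * |s| * ‖u‖ := by
      field_simp
      ring
    linarith
  rw [sq_abs] at hyoung
  rw [mul_pow, sq_abs] at hnorm
  linear_combination κ / 4 * hnorm + hBu + hBw + hyoung

end Coercivity

section StrongConvexity

variable {V : Type*} [NormedAddCommGroup V] [NormedSpace ℝ V]

theorem convexOn_comp_lineMap_sub_sq {s : Set V} {f : V → ℝ} {f' : V → V →L[ℝ] ℝ} {m : ℝ}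
    (hs : Convex ℝ s) (hf : ∀ x ∈ s, HasFDerivAt f (f' x) x)
    (hmono : ∀ x ∈ s, ∀ y ∈ s, m * ‖x - y‖ ^ 2 ≤ (f' x - f' y) (x - y)) {x y : V} (hx : x ∈ s)
    (hy : y ∈ s) :
    ConvexOn ℝ (Icc (0 : ℝ) 1)
      fun t => f (AffineMap.lineMap (k := ℝ) x y t) - m / 2 * ‖x - y‖ ^ 2 * t ^ 2 := by
  set γ : ℝ →ᵃ[ℝ] V := AffineMap.lineMap x y
  set φ : ℝ → ℝ := fun t => f (γ t) - m / 2 * ‖x - y‖ ^ 2 * t ^ 2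
  have hγ : ∀ t ∈ Icc (0 : ℝ) 1, γ t ∈ s := fun t ht => hs.lineMap_mem hx hy ht
  have hφ : ∀ t ∈ Icc (0 : ℝ) 1,
      HasDerivAt φ (f' (γ t) (y - x) - m / 2 * ‖x - y‖ ^ 2 * (2 * t)) t := fun t ht => by
    have hsq : HasDerivAt (fun t : ℝ => t ^ 2) (2 * t) t := by simpa using hasDerivAt_pow 2 t
    exact ((hf _ (hγ t ht)).comp_hasDerivAt t AffineMap.hasDerivAt_lineMap).sub (hsq.const_mul _)
  refine MonotoneOn.convexOn_of_deriv (convex_Icc 0 1)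
    (fun t ht => (hφ t ht).continuousAt.continuousWithinAt)
    (fun t ht => (hφ t (interior_subset ht)).differentiableAt.differentiableWithinAt) ?_
  intro t ht u hu htu
  replace ht := interior_subset ht
  replace hu := interior_subset hu
  rw [(hφ t ht).deriv, (hφ u hu).deriv]
  rcases htu.eq_or_lt with rfl | htu
  · rfl
  have hdiff : γ u - γ t = (u - t) • (y - x) := by
    simp only [γ, AffineMap.lineMap_apply_module']
    module
  have hgrow := hmono _ (hγ u hu) _ (hγ t ht)
  rw [hdiff, norm_smul, map_smul, smul_eq_mul, mul_pow, Real.norm_eq_abs, sq_abs, sub_apply,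
    norm_sub_rev y x] at hgrow
  have hcancel : m * (u - t) * ‖x - y‖ ^ 2 ≤ f' (γ u) (y - x) - f' (γ t) (y - x) :=
    le_of_mul_le_mul_left (by linarith) (sub_pos.2 htu)
  linarith

theorem strongConvexOn_of_stronglyMonotone {s : Set V} {f : V → ℝ} {f' : V → V →L[ℝ] ℝ} {m : ℝ}
    (hs : Convex ℝ s) (hf : ∀ x ∈ s, HasFDerivAt f (f' x) x)
    (hmono : ∀ x ∈ s, ∀ y ∈ s, m * ‖x - y‖ ^ 2 ≤ (f' x - f' y) (x - y)) :
    StrongConvexOn s m f := by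
  refine ⟨hs, fun x hx y hy a b ha hb hab => ?_⟩
  have h := (convexOn_comp_lineMap_sub_sq hs hf hmono hx hy).2
    (left_mem_Icc.2 zero_le_one) (right_mem_Icc.2 zero_le_one) ha hb hab
  obtain rfl : a = 1 - b := by linarith
  simp only [smul_eq_mul, mul_zero, mul_one, zero_add, one_pow, AffineMap.lineMap_apply_zero,
    AffineMap.lineMap_apply_one, AffineMap.lineMap_apply_module x y b] at h
  simp only [smul_eq_mul]
  linarith

theorem exists_strongConvexOn_ball {f : V → ℝ} {p : V} {m c : ℝ} (hf : ContDiffAt ℝ 2 f p)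
    (hmc : m < c) (hc : ∀ w, c * ‖w‖ ^ 2 ≤ fderiv ℝ (fderiv ℝ f) p w w) :
    ∃ r : ℝ, 0 < r ∧ StrongConvexOn (ball p r) m f := by
  have hstrict : HasStrictFDerivAt (fderiv ℝ f) (fderiv ℝ (fderiv ℝ f) p) p :=
    (hf.fderiv_right (m := 1) (by norm_num)).hasStrictFDerivAt one_ne_zero
  have hmono : ∀ᶠ xy : V × V in 𝓝 p ×ˢ 𝓝 p,
      m * ‖xy.1 - xy.2‖ ^ 2 ≤ (fderiv ℝ f xy.1 - fderiv ℝ f xy.2) (xy.1 - xy.2) := by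
    rw [← nhds_prod_eq]
    filter_upwards [hstrict.isLittleO.def (sub_pos.2 hmc)] with ⟨x, y⟩ hxy
    have herr := neg_le_of_abs_le ((ContinuousLinearMap.le_opNorm _ (x - y)).trans
      (mul_le_mul_of_nonneg_right hxy (norm_nonneg (x - y))))
    rw [sub_apply] at herr
    linarith [hc (x - y)]
  have hdiff : ∀ᶠ x in 𝓝 p, DifferentiableAt ℝ f x :=
    (hf.eventually (by simp)).mono fun x hx => hx.differentiableAt two_ne_zero
  obtain ⟨N, hN, hNmono⟩ := eventually_prod_self_iff
    (r := fun x y => m * ‖x - y‖ ^ 2 ≤ (fderiv ℝ f x - fderiv ℝ f y) (x - y)) |>.1 hmono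
  obtain ⟨r, hr, hball⟩ := eventually_nhds_iff_ball.1 (hdiff.and hN)
  exact ⟨r, hr, strongConvexOn_of_stronglyMonotone (convex_ball p r)
    (fun x hx => (hball x hx).1.hasFDerivAt)
    fun x hx y hy => hNmono x (hball x hx).2 y (hball y hy).2⟩

theorem exists_strongConcaveOn_const_mul {β : V → ℝ} (hβ : ContDiff ℝ 2 β)
    (hβc : HasCompactSupport β) :
    ∃ M : ℝ, ∀ t : ℝ, StrongConcaveOn univ (-(M * |t|)) fun x => t * β x := by
  obtain ⟨M, hM⟩ := (hβ.fderiv_right (m := 1) (by norm_num)).lipschitzWith_of_hasCompactSupport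
    (hβc.fderiv ℝ) one_ne_zero
  refine ⟨M, fun t => ?_⟩
  have hneg : StrongConvexOn univ (-(M * |t|)) fun x => -(t * β x) := by
    refine strongConvexOn_of_stronglyMonotone (f' := fun x => -(t • fderiv ℝ β x)) convex_univ
      (fun x _ => ((hβ.differentiable two_ne_zero x).hasFDerivAt.const_mul t).neg)
      fun x _ y _ => ?_
    have hLip : |(fderiv ℝ β x - fderiv ℝ β y) (x - y)| ≤ M * ‖x - y‖ ^ 2 := by
      calc |(fderiv ℝ β x - fderiv ℝ β y) (x - y)|
          ≤ ‖fderiv ℝ β x - fderiv ℝ β y‖ * ‖x - y‖ :=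
            (fderiv ℝ β x - fderiv ℝ β y).le_opNorm (x - y)
        _ ≤ M * ‖x - y‖ * ‖x - y‖ := by gcongr; simpa [dist_eq_norm] using hM.dist_le_mul x y
        _ = M * ‖x - y‖ ^ 2 := by ring
    have hsplit : (-(t • fderiv ℝ β x) - -(t • fderiv ℝ β y)) (x - y) =
        -(t * (fderiv ℝ β x - fderiv ℝ β y) (x - y)) := by
      simp only [sub_apply, neg_apply, smul_apply, smul_eq_mul]
      ring
    rw [hsplit, neg_mul, neg_le_neg_iff]
    calc t * (fderiv ℝ β x - fderiv ℝ β y) (x - y)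
        ≤ |t| * |(fderiv ℝ β x - fderiv ℝ β y) (x - y)| := (le_abs_self _).trans_eq (abs_mul _ _)
      _ ≤ |t| * (M * ‖x - y‖ ^ 2) := by gcongr
      _ = M * |t| * ‖x - y‖ ^ 2 := by ring
  simpa [StrongConcaveOn, Pi.neg_def] using UniformConvexOn.neg hneg

end StrongConvexity

section LocalConcavity

theorem lowerSemicontinuousOn_of_concaveOn {s : Set ℝ} {φ : ℝ → ℝ} (hφ : ConcaveOn ℝ s φ) :
    LowerSemicontinuousOn φ s := by
  intro t ht y hy
  have hchord : ∀ e ∈ s, e ≠ t → ∀ᶠ a in 𝓝 t, a ∈ segment ℝ t e → y < φ a := by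
    intro e he het
    have hcont : ContinuousAt (fun a => φ t + (a - t) / (e - t) * (φ e - φ t)) t := by fun_prop
    filter_upwards [hcont.eventually (lt_mem_nhds (by simpa using hy))] with a hya ha
    obtain ⟨α, b, hα, hb, hab, rfl⟩ := ha
    have hquot : (α • t + b • e - t) / (e - t) = b := by
      rw [div_eq_iff (sub_ne_zero.2 het), smul_eq_mul, smul_eq_mul]
      linear_combination t * hab
    have hconc := hφ.2 ht he hα hb hab
    rw [hquot] at hya
    simp only [smul_eq_mul] at hconc ⊢
    linear_combination hya + hconc - φ t * hab
  have hright : ∀ᶠ a in 𝓝 t, a ∈ s → t < a → y < φ a := by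
    by_cases h : ∃ e ∈ s, t < e
    · obtain ⟨e, he, hte⟩ := h
      filter_upwards [hchord e he hte.ne', gt_mem_nhds hte] with a ha hae _ hta
      exact ha (Icc_subset_segment ⟨hta.le, hae.le⟩)
    · exact Eventually.of_forall fun a has hta => (h ⟨a, has, hta⟩).elim
  have hleft : ∀ᶠ a in 𝓝 t, a ∈ s → a < t → y < φ a := by
    by_cases h : ∃ e ∈ s, e < t
    · obtain ⟨e, he, het⟩ := h
      filter_upwards [hchord e he het.ne, lt_mem_nhds het] with a ha hea _ hat
      exact ha (segment_symm ℝ e t ▸ Icc_subset_segment ⟨hea.le, hat.le⟩)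
    · exact Eventually.of_forall fun a has hat => (h ⟨a, has, hat⟩).elim
  filter_upwards [mem_nhdsWithin_of_mem_nhds hright, mem_nhdsWithin_of_mem_nhds hleft,
    self_mem_nhdsWithin] with a hr hl has
  rcases lt_trichotomy a t with hat | rfl | hta
  exacts [hl has hat, hy, hr has hta]

-- The largest minimizer of `φ` cannot be an interior point, by concavity near it.
theorem nonneg_of_locally_concaveOn {φ : ℝ → ℝ}
    (hφ : ∀ t ∈ Icc (0 : ℝ) 1, ∃ u ∈ 𝓝 t, ConcaveOn ℝ (Icc 0 1 ∩ u) φ) (h0 : 0 ≤ φ 0)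
    (h1 : 0 ≤ φ 1) : ∀ t ∈ Icc (0 : ℝ) 1, 0 ≤ φ t := by
  have hlsc : LowerSemicontinuousOn φ (Icc 0 1) := fun t ht => by
    obtain ⟨u, hu, hconc⟩ := hφ t ht
    have h := lowerSemicontinuousOn_of_concaveOn hconc t ⟨ht, mem_of_mem_nhds hu⟩
    rwa [SemicontinuousWithinAt,
      nhdsWithin_inter_of_mem' (mem_nhdsWithin_of_mem_nhds hu)] at h
  obtain ⟨t₀, ht₀, hmin⟩ := hlsc.exists_isMinOn (nonempty_Icc.2 zero_le_one) isCompact_Icc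
  obtain ⟨t, ⟨htI, htmin⟩, htmax⟩ := (hlsc.isCompact_inter_preimage_Iic isCompact_Icc
    (φ t₀)).exists_isGreatest ⟨t₀, ht₀, le_refl (φ t₀)⟩
  suffices 0 ≤ φ t from fun a ha => this.trans (htmin.trans (hmin ha))
  by_contra! hneg
  have ht0 : 0 < t := htI.1.lt_of_ne (by rintro rfl; exact h0.not_gt hneg)
  have ht1 : t < 1 := htI.2.lt_of_ne (by rintro rfl; exact h1.not_gt hneg)
  obtain ⟨u, hu, hconc⟩ := hφ t htI
  obtain ⟨η, hη, hball⟩ := nhds_basis_closedBall.mem_iff.1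
    (inter_mem (Icc_mem_nhds ht0 ht1) hu)
  rw [Real.closedBall_eq_Icc] at hball
  have hl : t - η ∈ Icc (0 : ℝ) 1 ∩ u := hball ⟨le_rfl, by linarith⟩
  have hr : t + η ∈ Icc (0 : ℝ) 1 ∩ u := hball ⟨by linarith, le_rfl⟩
  have hφr : φ t₀ < φ (t + η) := by
    by_contra! hle
    linarith [htmax ⟨hr.1, hle⟩]
  have hmid := hconc.2 hl hr one_half_pos.le one_half_pos.le (add_halves 1)
  have hφl : φ t₀ ≤ φ (t - η) := hmin hl.1
  have hφt : φ t ≤ φ t₀ := htmin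
  rw [show (1 / 2 : ℝ) • (t - η) + (1 / 2 : ℝ) • (t + η) = t by
    simp only [smul_eq_mul]; ring] at hmid
  simp only [smul_eq_mul] at hmid
  linarith

variable {V : Type*} [NormedAddCommGroup V] [NormedSpace ℝ V] {C : Set V}

theorem concaveOn_of_locally_concaveOn {f : V → ℝ} (hC : Convex ℝ C)
    (hf : ∀ x ∈ C, ∃ u ∈ 𝓝 x, ConcaveOn ℝ (C ∩ u) f) : ConcaveOn ℝ C f := by
  refine ⟨hC, fun x hx y hy a b ha hb hab => ?_⟩
  let γ : ℝ →ᵃ[ℝ] V := AffineMap.lineMap x y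
  have hγ : ∀ t ∈ Icc (0 : ℝ) 1, γ t ∈ C := fun t ht => hC.lineMap_mem hx hy ht
  let φ : ℝ → ℝ := fun t => f (γ t) + (t * (f x - f y) - f x)
  have hφ : ∀ t ∈ Icc (0 : ℝ) 1, ∃ u ∈ 𝓝 t, ConcaveOn ℝ (Icc 0 1 ∩ u) φ := by
    intro t ht
    obtain ⟨u, hu, hconc⟩ := hf (γ t) (hγ t ht)
    have hsub : Icc (0 : ℝ) 1 ∩ γ ⁻¹' u ⊆ γ ⁻¹' (C ∩ u) := fun a ha => ⟨hγ a ha.1, ha.2⟩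
    have hconv : Convex ℝ (Icc (0 : ℝ) 1 ∩ γ ⁻¹' u) := by
      have heq : Icc (0 : ℝ) 1 ∩ γ ⁻¹' u = Icc 0 1 ∩ γ ⁻¹' (C ∩ u) :=
        Subset.antisymm (fun a ha => ⟨ha.1, hsub ha⟩) fun a ha => ⟨ha.1, ha.2.2⟩
      rw [heq]
      exact (convex_Icc 0 1).inter (hconc.1.affine_preimage γ)
    refine ⟨γ ⁻¹' u, AffineMap.lineMap_continuous.continuousAt hu,
      ((hconc.comp_affineMap γ).subset hsub hconv).add ?_⟩
    exact ⟨hconv, fun p _ q _ c d _ _ hcd => le_of_eq (by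
      simp only [smul_eq_mul]; linear_combination (-f x) * hcd)⟩
  have hγb : γ b = a • x + b • y := by
    obtain rfl : a = 1 - b := by linarith
    exact AffineMap.lineMap_apply_module x y b
  have hφb := nonneg_of_locally_concaveOn hφ (by simp [φ, γ]) (by simp [φ, γ]) b
    ⟨hb, by linarith⟩
  simp only [φ, hγb] at hφb
  simp only [smul_eq_mul]
  linear_combination hφb + f x * hab

/- On the support of `β` the strong concavity of `g` absorbs the second derivative of `t * β`; off
the support nothing changes. -/
theorem eventually_concaveOn_add_mul {g β : V → ℝ} {m : ℝ} (hg : ConcaveOn ℝ C g) (hm : 0 < m)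
    (hβ : ContDiff ℝ 2 β) (hβc : HasCompactSupport β)
    (hgβ : ∀ x ∈ C ∩ tsupport β, ∃ u ∈ 𝓝 x, StrongConcaveOn (C ∩ u) m g) :
    ∀ᶠ t in 𝓝 (0 : ℝ), ConcaveOn ℝ C fun x => g x + t * β x := by
  obtain ⟨M, hβM⟩ := exists_strongConcaveOn_const_mul hβ hβc
  have hsmall : ∀ᶠ t in 𝓝 (0 : ℝ), M * |t| < m := by
    have hcont : ContinuousAt (fun t : ℝ => M * |t|) 0 := by fun_prop
    exact hcont.eventually (gt_mem_nhds (by simpa using hm))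
  filter_upwards [hsmall] with t ht
  refine concaveOn_of_locally_concaveOn hg.1 fun x hx => ?_
  by_cases hxβ : x ∈ tsupport β
  · obtain ⟨u, hu, hconc⟩ := hgβ x ⟨hx, hxβ⟩
    have hpert : StrongConcaveOn (C ∩ u) (-(M * |t|)) fun x => t * β x :=
      ⟨hconc.1, fun y _ z _ => (hβM t).2 (mem_univ y) (mem_univ z)⟩
    refine ⟨u, hu, (hconc.add hpert).concaveOn fun s => ?_⟩
    have hpos : 0 ≤ (m - M * |t|) / 2 * s ^ 2 := by
      have := sub_nonneg.2 ht.le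
      positivity
    simpa only [Pi.zero_apply, Pi.add_apply, neg_div, sub_div, sub_mul, neg_mul, ← sub_eq_add_neg]
      using hpos
  · obtain ⟨r, hr, hball⟩ := nhds_basis_ball.mem_iff.1
      ((isClosed_tsupport β).isOpen_compl.mem_nhds hxβ)
    refine ⟨ball x r, ball_mem_nhds x hr,
      (hg.subset inter_subset_left (hg.1.inter (convex_ball x r))).congr fun y hy => ?_⟩
    simp [image_eq_zero_of_notMem_tsupport (hball hy.2)]

end LocalConcavity

theorem exists_odd_bump {V : Type*} [NormedAddCommGroup V] [NormedSpace ℝ V] [HasContDiffBump V]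
    [FiniteDimensional ℝ V] {x₀ : V} (hx₀ : x₀ ≠ 0) {δ : ℝ} (hδ : 0 < δ) :
    ∃ β : V → ℝ, ContDiff ℝ 2 β ∧ HasCompactSupport β ∧
      tsupport β ⊆ closedBall x₀ δ ∪ closedBall (-x₀) δ ∧
      (∀ x, β (-x) = -β x) ∧ β x₀ = 1 ∧ β ((1 / 2 : ℝ) • x₀) = 0 := by
  have : 0 < ‖x₀‖ := norm_pos_iff.2 hx₀
  set η := min δ (‖x₀‖ / 2)
  have hη0 : 0 < η := by positivity
  have hηx : η ≤ ‖x₀‖ / 2 := min_le_right _ _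
  let φ : ContDiffBump (0 : V) := ⟨η / 2, η, by positivity, by linarith⟩
  have hφ0 : ∀ x, η ≤ ‖x‖ → φ x = 0 := fun x hx => φ.zero_of_le_dist (by simpa using hx)
  let β : V → ℝ := fun x => φ (x - x₀) - φ (x + x₀)
  have hsupp : ∀ x, x ∉ closedBall x₀ η ∪ closedBall (-x₀) η → β x = 0 := by
    intro x hx
    rw [mem_union, not_or, mem_closedBall_iff_norm, mem_closedBall_iff_norm, not_le, not_le,
      sub_neg_eq_add] at hx
    simp only [β, hφ0 _ hx.1.le, hφ0 _ hx.2.le, sub_zero]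
  refine ⟨β, ?_, HasCompactSupport.intro
    ((isCompact_closedBall x₀ η).union (isCompact_closedBall (-x₀) η)) hsupp, ?_, fun x => ?_,
    ?_, ?_⟩
  · exact (φ.contDiff.comp (contDiff_id.sub contDiff_const)).sub
      (φ.contDiff.comp (contDiff_id.add contDiff_const))
  · refine closure_minimal (fun x hx => ?_) (isClosed_closedBall.union isClosed_closedBall)
    exact union_subset_union (closedBall_subset_closedBall (min_le_left _ _))
      (closedBall_subset_closedBall (min_le_left _ _)) (not_imp_comm.1 (hsupp x) hx)
  · simp only [β]
    rw [← φ.neg (-x - x₀), ← φ.neg (-x + x₀), neg_sub', neg_add, neg_neg, neg_sub,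
      sub_neg_eq_add, ← sub_eq_add_neg]
  · have hnorm : ‖x₀ + x₀‖ = 2 * ‖x₀‖ := by simp [← two_smul ℝ x₀, norm_smul]
    simp only [β, sub_self, φ.one_of_mem_closedBall (mem_closedBall_self φ.rIn_pos.le),
      hφ0 (x₀ + x₀) (by linarith), sub_zero]
  · have hsub : (1 / 2 : ℝ) • x₀ - x₀ = (-1 / 2 : ℝ) • x₀ := by module
    have hadd : (1 / 2 : ℝ) • x₀ + x₀ = (3 / 2 : ℝ) • x₀ := by module
    simp only [β, hsub, hadd]
    rw [hφ0, hφ0, sub_zero] <;> rw [norm_smul] <;> norm_num <;> linarith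

section StronglyConvexSet

variable {V : Type*} [NormedAddCommGroup V] [NormedSpace ℝ V] {K S : Set V} {c : ℝ}

/-- Quantitative strict convexity of `K` inside `S`: around each convex combination
`a • x + b • y` of points of `K ∩ S`, the set `K` contains a ball of radius
`a * b * c * ‖x - y‖ ^ 2`. The factor `a * b` is the one in `StrongConvexOn`. -/
def StronglyConvexIn (K S : Set V) (c : ℝ) : Prop :=
  ∀ x ∈ K ∩ S, ∀ y ∈ K ∩ S, ∀ a b : ℝ, 0 ≤ a → 0 ≤ b → a + b = 1 →
    closedBall (a • x + b • y) (a * b * c * ‖x - y‖ ^ 2) ⊆ K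

theorem StronglyConvexIn.neg (h : StronglyConvexIn K S c) : StronglyConvexIn (-K) (-S) c := by
  intro x hx y hy a b ha hb hab z hz
  have hcomb : a • -x + b • -y = -(a • x + b • y) := by module
  have hdiff : ‖-x - -y‖ = ‖x - y‖ := by rw [neg_sub_neg, norm_sub_rev]
  refine h (-x) hx (-y) hy a b ha hb hab ?_
  rwa [hcomb, hdiff, mem_closedBall, dist_neg_neg]

theorem StronglyConvexIn.midpoint_mem_interior (h : StronglyConvexIn K S c) (hc : 0 < c) {x y : V}
    (hx : x ∈ K ∩ S) (hy : y ∈ K ∩ S) (hxy : x ≠ y) : midpoint ℝ x y ∈ interior K := by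
  have hball := h x hx y hy (1 / 2) (1 / 2) (by norm_num) (by norm_num) (by norm_num)
  have hmid : midpoint ℝ x y = (1 / 2 : ℝ) • x + (1 / 2 : ℝ) • y := by
    rw [midpoint_eq_smul_add, invOf_eq_inv, smul_add, one_div]
  rw [hmid, mem_interior_iff_mem_nhds]
  have := norm_pos_iff.2 (sub_ne_zero.2 hxy)
  exact mem_of_superset (closedBall_mem_nhds _ (by positivity)) hball

theorem stronglyConvexIn_of_strongConvexOn {σ : V → ℝ} {p : V} {R m : ℝ} {L : NNReal}
    (hR : 0 < R) (hc : 0 < c) (hcL : L * c ≤ m / 2) (hcR : c * R ≤ 1)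
    (hσ : StrongConvexOn (ball p R) m σ) (hL : LipschitzOnWith L σ (ball p R))
    (hK : ∀ x ∈ ball p R, x ∈ K ↔ σ x ≤ 0) : StronglyConvexIn K (ball p (R / 2)) c := by
  rintro x ⟨hxK, hx⟩ y ⟨hyK, hy⟩ a b ha hb hab z hz
  have hsub : ball p (R / 2) ⊆ ball p R := ball_subset_ball (by linarith)
  have hw : a • x + b • y ∈ ball p (R / 2) := convex_ball p (R / 2) hx hy ha hb hab
  set w := a • x + b • y
  set d := ‖x - y‖
  have hd : d ≤ R := by
    have := dist_triangle_right x y p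
    rw [dist_eq_norm] at this
    linarith [mem_ball.1 hx, mem_ball.1 hy]
  have hzR : z ∈ ball p R := by
    have hrad : a * b * c * d ^ 2 ≤ R / 2 := by
      calc a * b * c * d ^ 2 ≤ 1 / 2 * c * R ^ 2 := by
            gcongr
            nlinarith [sq_nonneg (a - b)]
        _ = c * R * (R / 2) := by ring
        _ ≤ 1 * (R / 2) := by gcongr
        _ = R / 2 := one_mul _
    have := dist_triangle z w p
    rw [mem_ball] at hw ⊢
    linarith [mem_closedBall.1 hz]
  have hσw : σ w ≤ -(a * b * (m / 2 * d ^ 2)) := by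
    have hconv := hσ.2 (hsub hx) (hsub hy) ha hb hab
    have hσx := mul_nonpos_of_nonneg_of_nonpos ha ((hK x (hsub hx)).1 hxK)
    have hσy := mul_nonpos_of_nonneg_of_nonpos hb ((hK y (hsub hy)).1 hyK)
    simp only [smul_eq_mul] at hconv
    linarith
  have hσz : σ z - σ w ≤ a * b * (m / 2 * d ^ 2) := by
    calc σ z - σ w ≤ dist (σ z) (σ w) := le_abs_self _
      _ ≤ L * dist z w := hL.dist_le_mul z hzR w (hsub hw)
      _ ≤ L * (a * b * c * d ^ 2) := by gcongr; exact hz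
      _ = L * c * (a * b * d ^ 2) := by ring
      _ ≤ m / 2 * (a * b * d ^ 2) := by gcongr
      _ = a * b * (m / 2 * d ^ 2) := by ring
  exact (hK z hzR).2 (by linarith)

theorem exists_stronglyConvexIn_of_strongConvexOn {σ : V → ℝ} {p : V} {R m : ℝ} {L : NNReal}
    (hR : 0 < R) (hm : 0 < m) (hσ : StrongConvexOn (ball p R) m σ)
    (hL : LipschitzOnWith L σ (ball p R)) (hK : ∀ x ∈ ball p R, x ∈ K ↔ σ x ≤ 0) :
    ∃ c : ℝ, 0 < c ∧ StronglyConvexIn K (ball p (R / 2)) c := by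
  have hc : 0 < min (m / 2 / (L + 1)) (1 / R) := by positivity
  refine ⟨_, hc, stronglyConvexIn_of_strongConvexOn hR hc ?_
    ((le_div_iff₀ hR).1 (min_le_right _ _)) hσ hL hK⟩
  have := (le_div_iff₀ (by positivity)).1 (min_le_left (m / 2 / (L + 1)) (1 / R))
  linarith

-- Radial projection onto the frontier fixes `p` and maps the dense set `Wᶜ` to itself.
theorem mem_closure_frontier_diff_submodule (hK : Convex ℝ K) (h0 : K ∈ 𝓝 0) {p : V}
    (hp : p ∈ frontier K) {W : Submodule ℝ V} (hW : W ≠ ⊤) :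
    p ∈ closure (frontier K \ W) := by
  have hdense : Dense (W : Set V)ᶜ := by
    rw [← interior_eq_empty_iff_dense_compl, ← not_nonempty_iff_eq_empty]
    exact fun h => hW (W.eq_top_of_nonempty_interior' h)
  have hgp : gauge K p = 1 := (gauge_eq_one_iff_mem_frontier hK h0).2 hp
  have hgauge : ContinuousAt (gauge K) p := continuousAt_gauge hK h0
  have hretract : Tendsto (fun y => (gauge K y)⁻¹ • y) (𝓝 p) (𝓝 p) := by
    have h : ContinuousAt (fun y => (gauge K y)⁻¹ • y) p :=
      (hgauge.inv₀ (by simp [hgp])).smul continuousAt_id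
    simpa [ContinuousAt, hgp] using h
  have hpos : ∀ᶠ y in 𝓝 p, 0 < gauge K y := hgauge.eventually (lt_mem_nhds (by simp [hgp]))
  refine mem_closure_of_frequently_of_tendsto ?_ hretract
  refine ((mem_closure_iff_frequently.1 (hdense p)).and_eventually hpos).mono ?_
  rintro y ⟨hyW, hy⟩
  refine ⟨(gauge_eq_one_iff_mem_frontier hK h0).1 ?_, ?_⟩
  · rw [gauge_smul_of_nonneg (inv_nonneg.2 hy.le), smul_eq_mul, inv_mul_cancel₀ hy.ne']
  · rwa [SetLike.mem_coe, W.smul_mem_iff (inv_ne_zero hy.ne')]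

end StronglyConvexSet

section Weingarten

variable {n : ℕ} {ρ : E n → ℝ} {p : E n}

theorem differentiableAt_gradient (hρ : ContDiffAt ℝ 2 ρ p) :
    DifferentiableAt ℝ (gradient ρ) p :=
  (InnerProductSpace.toDual ℝ (E n)).symm.toContinuousLinearEquiv.differentiableAt.comp p
    ((hρ.fderiv_right (m := 1) (by norm_num)).differentiableAt one_ne_zero)

theorem differentiableAt_inv_norm_gradient (hρ : ContDiffAt ℝ 2 ρ p) (hg : gradient ρ p ≠ 0) :
    DifferentiableAt ℝ (fun x => ‖gradient ρ x‖⁻¹) p :=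
  ((differentiableAt_gradient hρ).norm ℝ hg).inv (norm_ne_zero_iff.2 hg)

theorem differentiableAt_unitNormal (hρ : ContDiffAt ℝ 2 ρ p) (hg : gradient ρ p ≠ 0) :
    DifferentiableAt ℝ (unitNormal ρ) p :=
  (differentiableAt_inv_norm_gradient hρ hg).smul (differentiableAt_gradient hρ)

theorem inner_gradient_fderiv_unitNormal (hρ : ContDiffAt ℝ 2 ρ p) (hg : gradient ρ p ≠ 0)
    (w : E n) : ⟪gradient ρ p, fderiv ℝ (unitNormal ρ) p w⟫_ℝ = 0 := by
  have hν := differentiableAt_unitNormal hρ hg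
  have hunit : (fun x => ⟪unitNormal ρ x, unitNormal ρ x⟫_ℝ) =ᶠ[𝓝 p] fun _ => 1 := by
    filter_upwards [(differentiableAt_gradient hρ).continuousAt.eventually_ne hg] with x hx
    rw [real_inner_self_eq_norm_sq, unitNormal, norm_smul, norm_inv, norm_norm,
      inv_mul_cancel₀ (norm_ne_zero_iff.2 hx), one_pow]
  have hzero : ⟪unitNormal ρ p, fderiv ℝ (unitNormal ρ) p w⟫_ℝ = 0 := by
    have h := fderiv_inner_apply ℝ hν hν w
    rw [hunit.fderiv_eq, fderiv_fun_const, Pi.zero_apply, zero_apply] at h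
    rw [real_inner_comm (unitNormal ρ p)] at h
    linarith [real_inner_comm (unitNormal ρ p) (fderiv ℝ (unitNormal ρ) p w)]
  rw [unitNormal, inner_smul_left] at hzero
  exact (mul_eq_zero.1 hzero).resolve_left (inv_ne_zero (norm_ne_zero_iff.2 hg))

theorem inner_fderiv_unitNormal (hρ : ContDiffAt ℝ 2 ρ p) (hg : gradient ρ p ≠ 0) (w : E n)
    {u : E n} (hu : ⟪gradient ρ p, u⟫_ℝ = 0) :
    ⟪fderiv ℝ (unitNormal ρ) p w, u⟫_ℝ = ‖gradient ρ p‖⁻¹ * fderiv ℝ (fderiv ℝ ρ) p w u := by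
  have hN := (differentiableAt_inv_norm_gradient hρ hg).hasFDerivAt
  have hD : HasFDerivAt (fun x => fderiv ℝ ρ x u) ((fderiv ℝ (fderiv ℝ ρ) p).flip u) p :=
    ((ContinuousLinearMap.apply ℝ ℝ u).hasFDerivAt (x := fderiv ℝ ρ p)).comp p
      ((hρ.fderiv_right (m := 1) (by norm_num)).differentiableAt one_ne_zero).hasFDerivAt
  have hcomp : (fun x => ⟪unitNormal ρ x, u⟫_ℝ) = fun x => ‖gradient ρ x‖⁻¹ * fderiv ℝ ρ x u := by
    ext x
    rw [unitNormal, real_inner_smul_left, inner_gradient_left]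
  have h := fderiv_inner_apply ℝ (differentiableAt_unitNormal hρ hg) (differentiableAt_const u) w
  rw [hcomp, (hN.fun_mul hD).fderiv] at h
  rw [inner_gradient_left] at hu
  simpa [hu] using h.symm

end Weingarten

theorem fderiv_fderiv_add_mul_sq {V : Type*} [NormedAddCommGroup V] [NormedSpace ℝ V]
    {f : V → ℝ} {x : V} (hf : ContDiffAt ℝ 2 f x) (hfx : f x = 0) (A : ℝ) (w : V) :
    fderiv ℝ (fderiv ℝ fun y => f y + A / 2 * f y ^ 2) x w w =
      fderiv ℝ (fderiv ℝ f) x w w + A * fderiv ℝ f x w ^ 2 := by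
  have hfst : (fderiv ℝ fun y => f y + A / 2 * f y ^ 2) =ᶠ[𝓝 x]
      fun y => (1 + A * f y) • fderiv ℝ f y := by
    filter_upwards [hf.eventually (by simp)] with y hy
    have hy' := (hy.differentiableAt two_ne_zero).hasFDerivAt
    rw [(hy'.fun_add ((hy'.pow 2).const_mul (A / 2))).fderiv]
    module
  have hf' := (hf.differentiableAt two_ne_zero).hasFDerivAt
  have hf'' := ((hf.fderiv_right (m := 1) (by norm_num)).differentiableAt one_ne_zero).hasFDerivAt
  rw [hfst.fderiv_eq, (((hf'.const_mul A).const_add 1).fun_smul hf'').fderiv]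
  simp only [hfx, mul_zero, add_zero, one_smul, add_apply, smul_apply,
    ContinuousLinearMap.smulRight_apply, smul_eq_mul]
  ring

theorem inter_frontier_nonempty_of_isPreconnected {X : Type*} [TopologicalSpace X] {S K : Set X}
    (hS : IsPreconnected S) (hSi : (S ∩ interior K).Nonempty)
    (hSK : (S \ K).Nonempty) : (S ∩ frontier K).Nonempty := by
  by_contra hempty
  obtain ⟨x, hxS, hxK⟩ := hSK
  refine hxK (interior_subset (hS.subset_of_closure_inter_subset isOpen_interior hSi ?_ hxS))
  rintro y ⟨hy, hyS⟩
  by_contra hyi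
  exact hempty ⟨y, hyS, closure_mono interior_subset hy, hyi⟩

namespace IsLocalDefining

variable {n : ℕ} {K : Set (E n)} {p : E n} {W : Set (E n)} {ρ : E n → ℝ}

theorem contDiffAt (h : IsLocalDefining K p W ρ) : ContDiffAt ℝ 2 ρ p :=
  h.contDiffOn.contDiffAt (h.isOpen.mem_nhds h.mem)

theorem apply_eq_zero (h : IsLocalDefining K p W ρ) : ρ p = 0 :=
  (h.frontier_iff p h.mem).1 h.mem_frontier

theorem nonpos (h : IsLocalDefining K p W ρ) {x : E n} (hx : x ∈ W) (hxK : x ∈ K) : ρ x ≤ 0 := by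
  by_cases hi : x ∈ interior K
  · exact (h.neg_interior x hx hi).le
  · exact ((h.frontier_iff x hx).1 ⟨subset_closure hxK, hi⟩).le

theorem exists_coercive_ker (h : IsLocalDefining K p W ρ)
    (hcurv : ∀ κ, IsPrincipalCurvature K p κ → 0 < κ) :
    ∃ κ : ℝ, 0 < κ ∧ ∀ u, fderiv ℝ ρ p u = 0 →
      κ * ‖u‖ ^ 2 ≤ fderiv ℝ (fderiv ℝ ρ) p u u := by
  have hρ := h.contDiffAt
  have hg := h.gradient_ne_zero p h.mem
  have hgpos : 0 < ‖gradient ρ p‖ := norm_pos_iff.2 hg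
  let T : perp (gradient ρ p) →ₗ[ℝ] perp (gradient ρ p) :=
    (fderiv ℝ (unitNormal ρ) p).toLinearMap.restrict fun w _ =>
      Submodule.mem_orthogonal_singleton_iff_inner_right.2
        (inner_gradient_fderiv_unitNormal hρ hg w)
  have hT : ∀ w u, ⟪T w, u⟫_ℝ = ‖gradient ρ p‖⁻¹ * fderiv ℝ (fderiv ℝ ρ) p w u := fun w u =>
    inner_fderiv_unitNormal hρ hg w (Submodule.mem_orthogonal_singleton_iff_inner_right.1 u.2)
  have hsymm : T.IsSymmetric := fun w u => by
    rw [real_inner_comm, real_inner_comm, hT, real_inner_comm, hT,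
      hρ.isSymmSndFDerivAt (by simp) w u]
  obtain ⟨κ, hκ, hκT⟩ := exists_coercive_of_hasEigenvalue_pos hsymm fun μ hμ => by
    obtain ⟨w, hw, hw0⟩ := hμ.exists_hasEigenvector
    refine hcurv μ ⟨W, ρ, h, w, by simpa using hw0,
      Submodule.mem_orthogonal_singleton_iff_inner_right.1 w.2, ?_⟩
    exact congrArg Subtype.val (End.mem_eigenspace_iff.1 hw)
  refine ⟨‖gradient ρ p‖ * κ, by positivity, fun u hu => ?_⟩
  have hκu := hκT ⟨u, Submodule.mem_orthogonal_singleton_iff_inner_right.2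
    ((inner_gradient_left).trans hu)⟩
  rw [hT, inv_mul_eq_div, le_div_iff₀ hgpos] at hκu
  exact (by ring : ‖gradient ρ p‖ * κ * ‖u‖ ^ 2 = κ * ‖u‖ ^ 2 * ‖gradient ρ p‖).trans_le hκu

theorem fderiv_sub_neg (h : IsLocalDefining K p W ρ) (hK : Convex ℝ K) (hpK : p ∈ K) {z : E n}
    (hz : z ∈ interior K) : fderiv ℝ ρ p (z - p) < 0 := by
  have hmax : IsLocalMaxOn ρ K p := by
    filter_upwards [mem_nhdsWithin_of_mem_nhds (h.isOpen.mem_nhds h.mem), self_mem_nhdsWithin]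
      with x hx hxK
    exact (h.nonpos hx hxK).trans_eq h.apply_eq_zero.symm
  have hle : ∀ y ∈ K, fderiv ℝ ρ p (y - p) ≤ 0 := fun y hy =>
    hmax.hasFDerivWithinAt_nonpos
      (h.contDiffAt.differentiableAt two_ne_zero).hasFDerivAt.hasFDerivWithinAt
      (sub_mem_posTangentConeAt_of_segment_subset (hK.segment_subset hpK hy))
  refine (hle z (interior_subset hz)).lt_of_ne fun hzero => ?_
  have hzmax : IsLocalMax (fderiv ℝ ρ p) z := by
    filter_upwards [mem_interior_iff_mem_nhds.1 hz] with y hy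
    have := hle y hy
    rw [map_sub] at this hzero
    linarith
  refine h.gradient_ne_zero p h.mem ?_
  rw [gradient, hzmax.hasFDerivAt_eq_zero (fderiv ℝ ρ p).hasFDerivAt, map_zero]

theorem exists_ball_descent (h : IsLocalDefining K p W ρ) (hK : Convex ℝ K) (hpK : p ∈ K)
    {z : E n} (hz : z ∈ interior K) : ∃ r : ℝ, 0 < r ∧ ball p r ⊆ W ∧ ∀ x ∈ ball p r, ∀ t : ℝ,
      0 < t → x + t • (z - p) ∈ ball p r → ρ (x + t • (z - p)) < ρ x := by
  have hdesc : ∀ᶠ x in 𝓝 p, x ∈ W ∧ fderiv ℝ ρ x (z - p) < 0 := by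
    refine (h.isOpen.eventually_mem h.mem).and ?_
    have hcont : ContinuousAt (fun x => fderiv ℝ ρ x (z - p)) p :=
      (h.contDiffAt.fderiv_right (m := 1) (by norm_num)).continuousAt.clm_apply continuousAt_const
    exact hcont.eventually (gt_mem_nhds (h.fderiv_sub_neg hK hpK hz))
  obtain ⟨r, hr, hball⟩ := eventually_nhds_iff_ball.1 hdesc
  refine ⟨r, hr, fun x hx => (hball x hx).1, fun x hx t ht hxt => ?_⟩
  obtain ⟨y, hy, hmvt⟩ := domain_mvt (f' := fderiv ℝ ρ) (fun y hy =>
    ((h.contDiffOn.differentiableOn two_ne_zero y (hball y hy).1).differentiableAt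
      (h.isOpen.mem_nhds (hball y hy).1)).hasFDerivAt.hasFDerivWithinAt)
    (convex_ball p r) hx hxt
  rw [add_sub_cancel_left, map_smul, smul_eq_mul] at hmvt
  have hy' := (hball y ((convex_ball p r).segment_subset hx hxt hy)).2
  linarith [mul_neg_of_pos_of_neg ht hy']

theorem eventually_mem_of_nonpos (h : IsLocalDefining K p W ρ) (hK : Convex ℝ K)
    (hKc : IsClosed K) (hKi : (interior K).Nonempty) : ∀ᶠ x in 𝓝 p, ρ x ≤ 0 → x ∈ K := by
  obtain ⟨z, hz⟩ := hKi
  have hpK : p ∈ K := hKc.frontier_subset h.mem_frontier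
  obtain ⟨r, hr, hrW, hdesc⟩ := h.exists_ball_descent hK hpK hz
  obtain ⟨s, hs0, hsK, hsr⟩ : ∃ s : ℝ, 0 < s ∧ p + s • (z - p) ∈ interior K ∧
      p + s • (z - p) ∈ ball p r := by
    have hlim : Tendsto (fun s : ℝ => p + s • (z - p)) (𝓝[>] 0) (𝓝 p) :=
      tendsto_nhdsWithin_of_tendsto_nhds (Continuous.tendsto' (by fun_prop) _ _ (by simp))
    obtain ⟨s, hs, hsI⟩ := ((hlim.eventually (ball_mem_nhds p hr)).and
      (Ioo_mem_nhdsGT one_pos)).exists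
    exact ⟨s, hsI.1, hK.add_smul_sub_mem_interior hpK hz ⟨hsI.1, hsI.2.le⟩, hs⟩
  have hshift : ∀ᶠ x in 𝓝 p, x + s • (z - p) ∈ interior K ∩ ball p r :=
    ContinuousAt.eventually_mem (f := fun x => x + s • (z - p)) (by fun_prop)
      ((isOpen_interior.inter isOpen_ball).mem_nhds ⟨hsK, hsr⟩)
  filter_upwards [hshift, ball_mem_nhds p hr] with x hxs hxr hρx
  by_contra hxK
  obtain ⟨y, hy, hyK⟩ := inter_frontier_nonempty_of_isPreconnected
    (convex_segment x (x + s • (z - p))).isPreconnected ⟨_, right_mem_segment ℝ _ _, hxs.1⟩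
    ⟨x, left_mem_segment ℝ _ _, hxK⟩
  have hyr : y ∈ ball p r := (convex_ball p r).segment_subset hxr hxs.2 hy
  have hyx : y ≠ x := by rintro rfl; exact hxK (hKc.frontier_subset hyK)
  rw [segment_eq_image'] at hy
  obtain ⟨t, ht, rfl⟩ := hy
  simp only [add_sub_cancel_left, smul_smul] at hyr hyx hyK
  have ht0 : 0 < t := ht.1.lt_of_ne (by rintro rfl; simp at hyx)
  have hlt := hdesc x hxr (t * s) (mul_pos ht0 hs0) hyr
  rw [(h.frontier_iff _ (hrW hyr)).1 hyK] at hlt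
  exact hlt.not_ge hρx

theorem exists_stronglyConvexIn (h : IsLocalDefining K p W ρ) (hK : Convex ℝ K)
    (hKc : IsClosed K) (hKi : (interior K).Nonempty)
    (hcurv : ∀ κ, IsPrincipalCurvature K p κ → 0 < κ) :
    ∃ r c : ℝ, 0 < r ∧ 0 < c ∧ StronglyConvexIn K (ball p r) c := by
  obtain ⟨κ, hκ, hker⟩ := h.exists_coercive_ker hcurv
  obtain ⟨A, m, hm, hcoer⟩ := exists_coercive_add_mul_sq _ (fderiv ℝ ρ p) hκ hker
  set σ : E n → ℝ := fun x => ρ x + A / 2 * ρ x ^ 2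
  have hσ : ContDiffAt ℝ 2 σ p := h.contDiffAt.add (contDiffAt_const.mul (h.contDiffAt.pow 2))
  obtain ⟨r₁, hr₁, hconv⟩ := exists_strongConvexOn_ball hσ (half_lt_self hm)
    fun w => (hcoer w).trans_eq
      (fderiv_fderiv_add_mul_sq h.contDiffAt h.apply_eq_zero A w).symm
  obtain ⟨L, t, ht, hLip⟩ := (hσ.of_le one_le_two).exists_lipschitzOnWith
  have hfactor : ∀ᶠ x in 𝓝 p, 0 < 1 + A / 2 * ρ x := by
    have hcont : ContinuousAt (fun x => 1 + A / 2 * ρ x) p :=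
      continuousAt_const.add (continuousAt_const.mul h.contDiffAt.continuousAt)
    exact hcont.eventually (lt_mem_nhds (by simp [h.apply_eq_zero]))
  have hmem : ∀ᶠ x in 𝓝 p, x ∈ K ↔ σ x ≤ 0 := by
    filter_upwards [h.eventually_mem_of_nonpos hK hKc hKi, hfactor, h.isOpen.mem_nhds h.mem]
      with x hx hfx hxW
    have hσx : σ x = (1 + A / 2 * ρ x) * ρ x := by ring
    rw [hσx]
    exact ⟨fun hxK => mul_nonpos_of_nonneg_of_nonpos hfx.le (h.nonpos hxW hxK),
      fun hle => hx (nonpos_of_mul_nonpos_right hle hfx)⟩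
  obtain ⟨r₂, hr₂, hball⟩ := eventually_nhds_iff_ball.1 (hmem.and ht)
  have hR : 0 < min r₁ r₂ := lt_min hr₁ hr₂
  have hsub₁ : ball p (min r₁ r₂) ⊆ ball p r₁ := ball_subset_ball (min_le_left _ _)
  have hsub₂ : ball p (min r₁ r₂) ⊆ ball p r₂ := ball_subset_ball (min_le_right _ _)
  have hconvR : StrongConvexOn (ball p (min r₁ r₂)) (m / 2) σ :=
    ⟨convex_ball _ _, fun x hx y hy => hconv.2 (hsub₁ hx) (hsub₁ hy)⟩
  obtain ⟨c, hc, hKc⟩ := exists_stronglyConvexIn_of_strongConvexOn hR (half_pos hm) hconvR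
    (hLip.mono fun x hx => (hball x (hsub₂ hx)).2) fun x hx => (hball x (hsub₂ hx)).1
  exact ⟨_, c, half_pos hR, hc, hKc⟩

end IsLocalDefining

section SymmConvexBody

variable {n : ℕ} {K : Set (E n)}

theorem IsSymmConvexBody.neg_mem_iff (hK : IsSymmConvexBody K) {x : E n} : -x ∈ K ↔ x ∈ K := by
  rw [← Set.mem_neg, hK.neg_eq]

theorem IsSymmConvexBody.neg_interior_eq (hK : IsSymmConvexBody K) :
    -interior K = interior K := by
  have h : interior (-K) = -interior K := ((Homeomorph.neg (E n)).preimage_interior K).symm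
  rw [← h, hK.neg_eq]

theorem IsSymmConvexBody.neg_frontier_eq (hK : IsSymmConvexBody K) :
    -frontier K = frontier K := by
  have h : frontier (-K) = -frontier K := ((Homeomorph.neg (E n)).preimage_frontier K).symm
  rw [← h, hK.neg_eq]

theorem IsSymmConvexBody.zero_mem_interior (hK : IsSymmConvexBody K) : (0 : E n) ∈ interior K := by
  obtain ⟨z, hz⟩ := hK.interior_nonempty
  have hz' : -z ∈ interior K := by rwa [← Set.mem_neg, hK.neg_interior_eq]
  simpa using hK.convex.interior.midpoint_mem hz hz'

end SymmConvexBody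

section Shadow

variable {n : ℕ} {K : Set (E n)} {v : E n}

/-- The coordinate along `v`, in units of `v`, of the decomposition `ℝⁿ = v^⊥ ⊕ ℝ v`. -/
noncomputable def height (v : E n) : E n →L[ℝ] ℝ := (‖v‖ ^ 2)⁻¹ • innerSL ℝ v

theorem proj_add_height_smul (v X : E n) : (proj v X : E n) + height v X • v = X := by
  have h := (Submodule.span ℝ {v}).starProjection_add_starProjection_orthogonal X
  rw [Submodule.starProjection_singleton, add_comm] at h
  rw [height, smul_apply, innerSL_apply_apply, smul_eq_mul, inv_mul_eq_div]
  exact h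

theorem proj_add_smul (v X : E n) (s : ℝ) : proj v (X + s • v) = proj v X := by
  rw [map_add, map_smul,
    Submodule.orthogonalProjectionOnto_orthogonalComplement_singleton_eq_zero, smul_zero, add_zero]

theorem proj_sub_smul (v X : E n) (s : ℝ) : proj v (X - s • v) = proj v X := by
  rw [sub_eq_add_neg, ← neg_smul, proj_add_smul]

theorem proj_coe_add_smul (x : perp v) (s : ℝ) : proj v ((x : E n) + s • v) = x := by
  rw [proj_add_smul, Submodule.orthogonalProjectionOnto_mem_subspace_eq_self]

theorem height_add_smul (hv : v ≠ 0) (X : E n) (s : ℝ) :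
    height v (X + s • v) = height v X + s := by
  have hv' : ‖v‖ ^ 2 ≠ 0 := pow_ne_zero 2 (norm_ne_zero_iff.2 hv)
  rw [map_add, map_smul, height, smul_apply, smul_apply, innerSL_apply_apply, innerSL_apply_apply,
    real_inner_self_eq_norm_sq, smul_eq_mul, smul_eq_mul, smul_eq_mul, inv_mul_cancel₀ hv', mul_one]

theorem proj_sub_ne_zero {p q : E n} (hp : p ≠ 0) (hq : q ∉ Submodule.span ℝ {p}) :
    proj (p - q) p ≠ 0 := by
  intro hzero
  have hpv := proj_add_height_smul (p - q) p
  rw [hzero, Submodule.coe_zero, zero_add] at hpv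
  have hheight : height (p - q) p ≠ 0 := fun h => hp (by rw [← hpv, h, zero_smul])
  have hv : p - q = (height (p - q) p)⁻¹ • p :=
    ((inv_smul_eq_iff₀ hheight).2 hpv.symm).symm
  refine hq (Submodule.mem_span_singleton.2 ⟨1 - (height (p - q) p)⁻¹, ?_⟩)
  rw [sub_smul, one_smul, ← hv, sub_sub_cancel]

theorem proj_mem_interior_image {X : E n} (hX : X ∈ interior K) :
    proj v X ∈ interior (proj v '' K) := by
  have hsurj : Function.Surjective (proj v) := fun x =>
    ⟨x, Submodule.orthogonalProjectionOnto_mem_subspace_eq_self x⟩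
  exact (proj v).isOpenMap hsurj |>.image_interior_subset K ⟨X, hX, rfl⟩

theorem IsSymmConvexBody.neg_mem_image_proj (hK : IsSymmConvexBody K) {x : perp v}
    (hx : x ∈ proj v '' K) : -x ∈ proj v '' K := by
  obtain ⟨X, hX, rfl⟩ := hx
  exact ⟨-X, hK.neg_mem_iff.2 hX, map_neg _ _⟩

theorem mem_move_iff {β : perp v → ℝ} {t : ℝ} {X : E n} :
    X ∈ move K v β t ↔ X - (t * β (proj v X)) • v ∈ K := by
  constructor
  · rintro ⟨Y, hY, rfl⟩
    dsimp only
    rwa [proj_add_smul, add_sub_cancel_right]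
  · refine fun hX => ⟨_, hX, ?_⟩
    dsimp only
    rw [proj_sub_smul, sub_add_cancel]

/-- The height, in units of `v`, of the upper boundary of `K` over the point `x` of the shadow
`proj v '' K`; over other points the supremum has the junk value `0`. -/
noncomputable def upperHeight (K : Set (E n)) (v : E n) (x : perp v) : ℝ :=
  sSup {s : ℝ | (x : E n) + s • v ∈ K}

theorem bddAbove_fiber (hK : IsCompact K) (hv : v ≠ 0) (x : perp v) :
    BddAbove {s : ℝ | (x : E n) + s • v ∈ K} := by
  obtain ⟨B, hB⟩ := hK.bddAbove_image (height v).continuous.continuousOn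
  refine ⟨B - height v x, fun s hs => ?_⟩
  have hsB := hB (mem_image_of_mem (height v) hs)
  rw [height_add_smul hv] at hsB
  linarith

theorem le_upperHeight (hK : IsCompact K) (hv : v ≠ 0) {x : perp v} {s : ℝ}
    (hs : (x : E n) + s • v ∈ K) : s ≤ upperHeight K v x :=
  le_csSup (bddAbove_fiber hK hv x) hs

theorem height_le_upperHeight (hK : IsCompact K) (hv : v ≠ 0) {X : E n} (hX : X ∈ K) :
    height v X ≤ upperHeight K v (proj v X) :=
  le_upperHeight hK hv (by rwa [proj_add_height_smul])

theorem coe_add_upperHeight_smul_mem (hK : IsCompact K) (hv : v ≠ 0) {x : perp v}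
    (hx : x ∈ proj v '' K) : (x : E n) + upperHeight K v x • v ∈ K := by
  have hclosed : IsClosed {s : ℝ | (x : E n) + s • v ∈ K} :=
    hK.isClosed.preimage (f := fun s : ℝ => (x : E n) + s • v) (by fun_prop)
  refine hclosed.csSup_mem ?_ (bddAbove_fiber hK hv x)
  obtain ⟨X, hX, rfl⟩ := hx
  exact ⟨height v X, by rwa [mem_ofPred_eq, proj_add_height_smul]⟩

theorem concaveOn_upperHeight (hK : Convex ℝ K) (hKc : IsCompact K) (hv : v ≠ 0) :
    ConcaveOn ℝ (proj v '' K) (upperHeight K v) := by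
  refine ⟨hK.linear_image (proj v : E n →ₗ[ℝ] perp v), fun x hx y hy a b ha hb hab => ?_⟩
  have hmem := hK (coe_add_upperHeight_smul_mem hKc hv hx)
    (coe_add_upperHeight_smul_mem hKc hv hy) ha hb hab
  have hcomb : a • ((x : E n) + upperHeight K v x • v) + b • ((y : E n) + upperHeight K v y • v) =
      ((a • x + b • y : perp v) : E n) +
        (a • upperHeight K v x + b • upperHeight K v y) • v := by
    simp only [Submodule.coe_add, Submodule.coe_smul, smul_eq_mul]
    module
  rw [hcomb] at hmem
  exact le_upperHeight hKc hv hmem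

theorem upperHeight_proj_of_mem_frontier (hK : Convex ℝ K) (hKc : IsCompact K) (hv : v ≠ 0)
    {P : E n} (hP : P ∈ frontier K) {s : ℝ} (hs : 0 < s) (hPs : P - s • v ∈ interior K) :
    upperHeight K v (proj v P) = height v P := by
  have hPK : P ∈ K := hKc.isClosed.frontier_subset hP
  refine le_antisymm (le_of_not_gt fun hlt => hP.2 ?_) (height_le_upperHeight hKc hv hPK)
  obtain ⟨τ, hτ⟩ : ∃ τ, τ = upperHeight K v (proj v P) - height v P := ⟨_, rfl⟩
  have hτ0 : 0 < τ := hτ ▸ sub_pos.2 hlt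
  have htop : P + τ • v ∈ K := by
    have h : P + τ • v = (proj v P : E n) + upperHeight K v (proj v P) • v := by
      nth_rw 1 [← proj_add_height_smul v P]
      rw [hτ]
      module
    exact h ▸ coe_add_upperHeight_smul_mem hKc hv (mem_image_of_mem _ hPK)
  have hseg : P ∈ openSegment ℝ (P - s • v) (P + τ • v) := by
    refine ⟨τ / (s + τ), s / (s + τ), by positivity, by positivity, by field_simp; ring, ?_⟩
    match_scalars <;> field_simp <;> ring
  exact hK.openSegment_interior_self_subset_interior hPs htop hseg

theorem mem_iff_height_le (hK : IsSymmConvexBody K) (hv : v ≠ 0) {X : E n} :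
    X ∈ K ↔ proj v X ∈ proj v '' K ∧ height v X ≤ upperHeight K v (proj v X) ∧
      -height v X ≤ upperHeight K v (-proj v X) := by
  have hKc := hK.isCompact
  constructor
  · refine fun hX => ⟨mem_image_of_mem _ hX, height_le_upperHeight hKc hv hX, ?_⟩
    simpa only [map_neg] using height_le_upperHeight hKc hv (hK.neg_mem_iff.2 hX)
  · rintro ⟨hx, hup, hlow⟩
    have hupK := coe_add_upperHeight_smul_mem hKc hv hx
    have hlowK : (proj v X : E n) + (-upperHeight K v (-proj v X)) • v ∈ K := by
      rw [← hK.neg_mem_iff, neg_add, ← neg_smul, neg_neg, ← Submodule.coe_neg]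
      exact coe_add_upperHeight_smul_mem hKc hv (hK.neg_mem_image_proj hx)
    have hfiber : OrdConnected {s : ℝ | (proj v X : E n) + s • v ∈ K} :=
      ((hK.convex.translate_preimage_right (proj v X : E n)).linear_preimage
        (LinearMap.toSpanSingleton ℝ (E n) v)).ordConnected
    rw [← proj_add_height_smul v X]
    exact hfiber.out hlowK hupK ⟨neg_le.1 hlow, hup⟩

-- For odd `β`, `move K v β t` is `A ∩ -A`, where `A` is the region over the shadow of `K` below the
-- graph of `upperHeight K v + t * β`.
theorem convex_move (hK : IsSymmConvexBody K) (hv : v ≠ 0) {β : perp v → ℝ}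
    (hβ : ∀ x ∈ proj v '' K, β (-x) = -β x) {t : ℝ}
    (ht : ConcaveOn ℝ (proj v '' K) fun x => upperHeight K v x + t * β x) :
    Convex ℝ (move K v β t) := by
  let A : Set (E n) := {X | proj v X ∈ proj v '' K ∧
    height v X ≤ upperHeight K v (proj v X) + t * β (proj v X)}
  have hA : Convex ℝ A :=
    ht.convex_hypograph.linear_preimage ((proj v).prod (height v) : E n →ₗ[ℝ] perp v × ℝ)
  have hmove : move K v β t = A ∩ -A := by
    ext X
    have hheight : height v (X - (t * β (proj v X)) • v) = height v X - t * β (proj v X) := by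
      rw [sub_eq_add_neg, ← neg_smul, height_add_smul hv, ← sub_eq_add_neg]
    rw [mem_move_iff, mem_iff_height_le hK hv, hheight, proj_sub_smul]
    simp only [A, mem_inter_iff, Set.mem_neg, mem_ofPred_eq, map_neg]
    constructor
    · rintro ⟨hx, hup, hlow⟩
      rw [hβ _ hx]
      exact ⟨⟨hx, by linarith⟩, hK.neg_mem_image_proj hx, by linarith⟩
    · rintro ⟨⟨hx, hup⟩, -, hlow⟩
      rw [hβ _ hx] at hlow
      exact ⟨hx, by linarith, by linarith⟩
  exact hmove ▸ hA.inter hA.neg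

theorem StronglyConvexIn.exists_strongConcaveOn_upperHeight {S : Set (E n)} {c : ℝ}
    (h : StronglyConvexIn K S c) (hc : 0 ≤ c) (hS : IsOpen S) (hK : Convex ℝ K)
    (hKc : IsCompact K) (hv : v ≠ 0) {w : perp v} (hw : w ∈ interior (proj v '' K))
    (hwS : (w : E n) + upperHeight K v w • v ∈ S) :
    ∃ u ∈ 𝓝 w, StrongConcaveOn (proj v '' K ∩ u) (2 * c / ‖v‖) (upperHeight K v) := by
  have hconc := concaveOn_upperHeight hK hKc hv
  have hcont : ContinuousAt (fun x : perp v => (x : E n) + upperHeight K v x • v) w :=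
    continuous_subtype_val.continuousAt.add ((hconc.continuousOn_interior.continuousAt
      (isOpen_interior.mem_nhds hw)).smul continuousAt_const)
  obtain ⟨δ, hδ, hball⟩ := eventually_nhds_iff_ball.1 (hcont.eventually_mem (hS.mem_nhds hwS))
  refine ⟨ball w δ, ball_mem_nhds w hδ, hconc.1.inter (convex_ball w δ),
    fun x ⟨hx, hxδ⟩ y ⟨hy, hyδ⟩ a b ha hb hab => ?_⟩
  set X := (x : E n) + upperHeight K v x • v with hX
  set Y := (y : E n) + upperHeight K v y • v with hY
  have hxy : ‖x - y‖ ≤ ‖X - Y‖ := by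
    have hproj : proj v (X - Y) = x - y := by
      rw [map_sub, hX, hY, proj_coe_add_smul, proj_coe_add_smul]
    exact hproj ▸ Submodule.norm_orthogonalProjectionOnto_apply_le _ _
  have hmem : a • X + b • Y + (a * b * c * ‖x - y‖ ^ 2 / ‖v‖) • v ∈ K := by
    refine h X ⟨coe_add_upperHeight_smul_mem hKc hv hx, hball x hxδ⟩
      Y ⟨coe_add_upperHeight_smul_mem hKc hv hy, hball y hyδ⟩ a b ha hb hab ?_
    rw [mem_closedBall_iff_norm, add_sub_cancel_left, norm_smul,
      Real.norm_of_nonneg (by positivity), div_mul_cancel₀ _ (norm_ne_zero_iff.2 hv)]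
    gcongr
  have hcomb : a • X + b • Y + (a * b * c * ‖x - y‖ ^ 2 / ‖v‖) • v =
      ((a • x + b • y : perp v) : E n) + (a • upperHeight K v x + b • upperHeight K v y +
        a * b * (2 * c / ‖v‖ / 2 * ‖x - y‖ ^ 2)) • v := by
    simp only [hX, hY, Submodule.coe_add, Submodule.coe_smul, smul_eq_mul]
    module
  exact le_upperHeight hKc hv (hcomb ▸ hmem)

end Shadow

section Decomposition

variable {n : ℕ} {K : Set (E n)}

theorem srsDecomposable_of_eventually_concaveOn (hK : IsSymmConvexBody K) {v : E n} (hv : v ≠ 0)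
    {β : perp v → ℝ} (hodd : ∀ x ∈ proj v '' K, β (-x) = -β x)
    (hlin : ¬IsLinearOn β (proj v '' K))
    (hconc : ∀ᶠ t in 𝓝 (0 : ℝ), ConcaveOn ℝ (proj v '' K) fun x => upperHeight K v x + t * β x) :
    SRSDecomposable K := by
  obtain ⟨ε, hε, hball⟩ := eventually_nhds_iff_ball.1 hconc
  have hconvex : ∀ t ∈ Ioo (-ε) ε, Convex ℝ (move K v β t) := fun t ht =>
    convex_move hK hv hodd (hball t (by rwa [Real.ball_eq_Ioo, zero_sub, zero_add]))
  exact ⟨v, β, ε, hε, ⟨⟨hv, ordConnected_Ioo, by simpa using hε, hconvex⟩, hodd⟩,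
    by simp [move], hlin⟩

theorem not_isLinearOn_of_half_smul {v : E n} {β : perp v → ℝ} {S : Set (perp v)} {x₀ : perp v}
    (hx₀ : x₀ ∈ S) (hhalf : (1 / 2 : ℝ) • x₀ ∈ S) (hβ : β x₀ ≠ 0)
    (hβhalf : β ((1 / 2 : ℝ) • x₀) = 0) : ¬IsLinearOn β S := by
  rintro ⟨l, hl⟩
  rw [hl _ hhalf, map_smul, ← hl _ hx₀, smul_eq_mul] at hβhalf
  exact hβ (by linarith)

theorem srsDecomposable_of_strongConcaveOn_upperHeight (hK : IsSymmConvexBody K) {v : E n}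
    (hv : v ≠ 0) {x₀ : perp v} (hx₀ : x₀ ≠ 0) (hx₀K : x₀ ∈ proj v '' K) {m : ℝ} (hm : 0 < m)
    (hpos : ∃ u ∈ 𝓝 x₀, StrongConcaveOn (proj v '' K ∩ u) m (upperHeight K v))
    (hneg : ∃ u ∈ 𝓝 (-x₀), StrongConcaveOn (proj v '' K ∩ u) m (upperHeight K v)) :
    SRSDecomposable K := by
  obtain ⟨u₁, hu₁, hconc₁⟩ := hpos
  obtain ⟨u₂, hu₂, hconc₂⟩ := hneg
  obtain ⟨δ₁, hδ₁, hball₁⟩ := nhds_basis_closedBall.mem_iff.1 (eventually_mem_nhds_iff.2 hu₁)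
  obtain ⟨δ₂, hδ₂, hball₂⟩ := nhds_basis_closedBall.mem_iff.1 (eventually_mem_nhds_iff.2 hu₂)
  obtain ⟨β, hβ, hβc, hsupp, hodd, hβ₀, hβhalf⟩ := exists_odd_bump hx₀ (lt_min hδ₁ hδ₂)
  have hconc := concaveOn_upperHeight hK.convex hK.isCompact hv
  have hhalf : (1 / 2 : ℝ) • x₀ ∈ proj v '' K :=
    hconc.1.smul_mem_of_zero_mem ⟨0, interior_subset hK.zero_mem_interior, map_zero _⟩ hx₀K
      ⟨by norm_num, by norm_num⟩
  refine srsDecomposable_of_eventually_concaveOn hK hv (fun x _ => hodd x)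
    (not_isLinearOn_of_half_smul hx₀K hhalf (by rw [hβ₀]; exact one_ne_zero) hβhalf)
    (eventually_concaveOn_add_mul hconc hm hβ hβc ?_)
  rintro x ⟨-, hx⟩
  rcases hsupp hx with hx | hx
  · exact ⟨u₁, hball₁ (closedBall_subset_closedBall (min_le_left _ _) hx), hconc₁⟩
  · exact ⟨u₂, hball₂ (closedBall_subset_closedBall (min_le_right _ _) hx), hconc₂⟩

theorem exists_mem_frontier_ball_notMem_span (hn : 2 ≤ n) (hK : IsSymmConvexBody K) {p : E n}
    (hp : p ∈ frontier K) {r : ℝ} (hr : 0 < r) :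
    ∃ q ∈ frontier K ∩ ball p r, q ∉ Submodule.span ℝ {p} := by
  have hspan : Submodule.span ℝ {p} ≠ ⊤ := fun htop => by
    have hle := finrank_span_le_card (R := ℝ) ({p} : Set (E n))
    rw [htop, finrank_top, finrank_euclideanSpace_fin, toFinset_singleton,
      Finset.card_singleton] at hle
    omega
  obtain ⟨q, ⟨hq, hqp⟩, hqr⟩ := Metric.mem_closure_iff.1 (mem_closure_frontier_diff_submodule
    hK.convex (mem_interior_iff_mem_nhds.1 hK.zero_mem_interior) hp hspan) r hr
  exact ⟨q, ⟨hq, by rwa [mem_ball']⟩, hqp⟩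

theorem exists_strongConcaveOn_upperHeight_of_chord (hK : IsSymmConvexBody K) {p q : E n}
    (hp : p ∈ frontier K) (hpq : p ≠ q) {S : Set (E n)} (hS : IsOpen S) (hpS : p ∈ S) (hqS : q ∈ S)
    (hqK : q ∈ K) {c : ℝ} (hc : 0 < c) (h : StronglyConvexIn K S c) :
    ∃ u ∈ 𝓝 (proj (p - q) p),
      StrongConcaveOn (proj (p - q) '' K ∩ u) (2 * c / ‖p - q‖) (upperHeight K (p - q)) := by
  have hKc := hK.isCompact
  have hv : p - q ≠ 0 := sub_ne_zero.2 hpq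
  have hmid : p - (1 / 2 : ℝ) • (p - q) ∈ interior K := by
    have hm := h.midpoint_mem_interior hc ⟨hKc.isClosed.frontier_subset hp, hpS⟩ ⟨hqK, hqS⟩ hpq
    convert hm using 1
    rw [midpoint_eq_smul_add, invOf_eq_inv]
    module
  refine h.exists_strongConcaveOn_upperHeight hc.le hS hK.convex hKc hv
    (proj_sub_smul (p - q) p (1 / 2) ▸ proj_mem_interior_image hmid) ?_
  rwa [upperHeight_proj_of_mem_frontier hK.convex hKc hv hp one_half_pos hmid,
    proj_add_height_smul]

theorem srsDecomposable_of_stronglyConvexIn (hn : 2 ≤ n) (hK : IsSymmConvexBody K) {p : E n}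
    (hp : p ∈ frontier K) {r c : ℝ} (hr : 0 < r) (hc : 0 < c)
    (h : StronglyConvexIn K (ball p r) c) : SRSDecomposable K := by
  obtain ⟨q, ⟨hq, hqr⟩, hqp⟩ := exists_mem_frontier_ball_notMem_span hn hK hp hr
  have hpq : p ≠ q := by
    rintro rfl
    exact hqp (Submodule.mem_span_singleton_self p)
  have hpK := hK.isCompact.isClosed.frontier_subset hp
  have hqK := hK.isCompact.isClosed.frontier_subset hq
  have hv : p - q ≠ 0 := sub_ne_zero.2 hpq
  have hp0 : p ≠ 0 := by
    rintro rfl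
    exact hp.2 hK.zero_mem_interior
  have hpos := exists_strongConcaveOn_upperHeight_of_chord hK hp hpq isOpen_ball
    (mem_ball_self hr) hqr hqK hc h
  -- The chord from `-p` to `-q` has the same direction, but its upper endpoint is `-q`.
  have hneg := exists_strongConcaveOn_upperHeight_of_chord hK (p := -q) (q := -p)
    (by rwa [← Set.mem_neg, hK.neg_frontier_eq]) (by simpa using hpq.symm) isOpen_ball.neg
    (by simpa using hqr) (by simpa using hr) (hK.neg_mem_iff.2 hpK) hc (hK.neg_eq ▸ h.neg)
  have hqp' : proj (p - q) (-q) = -proj (p - q) p := by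
    rw [map_neg, ← proj_sub_smul (p - q) p 1, one_smul, sub_sub_cancel]
  rw [neg_sub_neg, hqp'] at hneg
  exact srsDecomposable_of_strongConcaveOn_upperHeight hK hv (proj_sub_ne_zero hp0 hqp)
    (mem_image_of_mem _ hpK) (by positivity) hpos hneg

end Decomposition

end SRS

theorem mainTheorem12_general {n : ℕ} (hn : 2 ≤ n) {K : Set (SRS.E n)}
    (hK : SRS.IsSymmConvexBody K) {p : SRS.E n} (hC2 : SRS.BoundaryC2At K p)
    (hcurv : ∀ κ : ℝ, SRS.IsPrincipalCurvature K p κ → 0 < κ) : SRS.SRSDecomposable K := by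
  obtain ⟨W, ρ, hρ⟩ := hC2
  obtain ⟨r, c, hr, hc, hball⟩ :=
    hρ.exists_stronglyConvexIn hK.convex hK.isCompact.isClosed hK.interior_nonempty hcurv
  exact SRS.srsDecomposable_of_stronglyConvexIn hn hK hρ.mem_frontier hr hc hball

theorem mainTheorem12 {n : ℕ} (hn : 2 ≤ n) (K : Set (SRS.E n)) (hK : SRS.IsSymmConvexBody K)
    (U : Set (SRS.E n)) (hUne : U.Nonempty)
    (hUopen : ∃ O : Set (SRS.E n), IsOpen O ∧ U = O ∩ frontier K)
    (hC2 : ∀ p ∈ U, SRS.BoundaryC2At K p)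
    (hcurv : ∀ p ∈ U, ∀ κ : ℝ, SRS.IsPrincipalCurvature K p κ → 0 < κ) :
    SRS.SRSDecomposable K := by
  obtain ⟨p, hp⟩ := hUne
  exact mainTheorem12_general hn hK (hC2 p hp) (hcurv p hp)
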